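/- A set $K\subset\mathbb{R}^2$ is a shape of constant width $1$ if it is nonempty, convex and compact and, for every unit vector $u$, its two parallel supporting lines with outward normals $u$ and $-u$, namely $\{x : x\cdot u=\max_{y\in K}y\cdot u\}$ and $\{x : x\cdot u=\min_{y\in K}y\cdot u\}$, are at distance $1$ from each other. A curve of constant width $1$ is the boundary $\Gamma=\partial K$ of such a shape. The area enclosed by $\Gamma$ is the Lebesgue measure of the union of the bounded connected components of $\mathbb{R}^2\setminus\Gamma$. Theorem. Every circle of radius $1/2$ in $\mathbb{R}^2$ is a curve of constant width $1$ and encloses area $\pi/4$. Every curve $\Gamma$ of constant width $1$ encloses area at most $\pi/4$, with equality if and only if $\Gamma$ is a circle of radius $1/2$. -/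

import Mathlib

open Set MeasureTheory
open scoped ENNReal

noncomputable section

/-- The Euclidean plane. -/
abbrev Plane : Type := EuclideanSpace ℝ (Fin 2)

/-- The support function of `K`, in the direction `u`: the largest value of `inner ℝ u x` for `x ∈ K`
(attained when `K` is nonempty and compact). -/
def supportFun (K : Set Plane) (u : Plane) : ℝ :=
  sSup ((fun x => inner ℝ u x) '' K)

/-- The supporting line of `K` with outward normal `u` (for `u` a unit vector). -/
def supportingLine (K : Set Plane) (u : Plane) : Set Plane :=
  {x | inner ℝ u x = supportFun K u}

/-- The distance between two sets: the infimum of `dist a b` over `a` in one, `b` in the other. -/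
def setDist (A B : Set Plane) : ℝ :=
  sInf (Set.image2 dist A B)

/-- A convex compact (nonempty) plane set `K` is a shape of constant width `w` if, for every
direction `u`, the two parallel supporting lines of `K` orthogonal to `u` are at distance `w`. -/
structure IsConstantWidthShape (w : ℝ) (K : Set Plane) : Prop where
  nonempty : K.Nonempty
  convex : Convex ℝ K
  isCompact : IsCompact K
  width_eq : ∀ u : Plane, ‖u‖ = 1 →
    setDist (supportingLine K u) (supportingLine K (-u)) = w

/-- A curve of constant width `w` is the boundary of a shape of constant width `w`. -/
def IsConstantWidthCurve (w : ℝ) (Γ : Set Plane) : Prop :=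
  ∃ K : Set Plane, IsConstantWidthShape w K ∧ Γ = frontier K

/-- The region enclosed by `Γ`: the union of the bounded connected components of the complement
of `Γ`. -/
def enclosedRegion (Γ : Set Plane) : Set Plane :=
  {x | x ∉ Γ ∧ Bornology.IsBounded (connectedComponentIn Γᶜ x)}

/-- The area (Lebesgue measure) enclosed by `Γ`. -/
def enclosedArea (Γ : Set Plane) : ℝ≥0∞ :=
  volume (enclosedRegion Γ)

end

/-! Width 1 forces diameter at most 1. Put the origin at the lowest point of the shape and let `ρ`
be its radial function. Folding the polar area at `π/2` gives the integral of `(ρ(t)² + ρ(t +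
π/2)²)/2` over `(0, π/2)`. The two points involved subtend a right angle at the origin, so by
Pythagoras the integrand is at most `1/2`, whence area at most `π/4` (`volume_le`).

If equality holds, the Pythagorean sum is 1 everywhere (`sq_add_sq_eq_one`). Comparing points at
nearly right angles then yields an ODE whose boundary values, given by the unit vertical chord,
force `ρ = sin` (`eq_cos_of_add_sq_le`). This is the disc of radius `1/2` tangent to the axis at the
origin. -/

/-! ### Rigidity of the radial function -/

theorem eq_cos_of_add_sq_le {r s : ℝ → ℝ} (hr : ∀ t, 0 ≤ r t) (hs : ∀ t, 0 ≤ s t)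
    (hrs : ∀ t ∈ Icc 0 (Real.pi / 2), r t ^ 2 + s t ^ 2 = 1)
    (hle : ∀ t ∈ Icc 0 (Real.pi / 2), ∀ u ∈ Icc 0 (Real.pi / 2),
      r t ^ 2 + s u ^ 2 + 2 * r t * s u * Real.sin (u - t) ≤ 1)
    (h0 : s 0 = 1) (h1 : s (Real.pi / 2) = 0) {t : ℝ} (ht : t ∈ Icc 0 (Real.pi / 2)) :
    s t = Real.cos t ∧ r t = Real.sin t := by
  have hpi := Real.pi_pos
  have hs1 : ∀ t ∈ Icc 0 (Real.pi / 2), s t ≤ 1 := fun t ht => by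
    nlinarith [hrs t ht, hs t, sq_nonneg (r t)]
  have hr1 : ∀ t ∈ Icc 0 (Real.pi / 2), r t ≤ 1 := fun t ht => by
    nlinarith [hrs t ht, hr t, sq_nonneg (s t)]
  have key : ∀ t ∈ Icc 0 (Real.pi / 2), ∀ u ∈ Icc 0 (Real.pi / 2),
      s u ^ 2 - s t ^ 2 ≤ - (2 * r t * s u) * Real.sin (u - t) := fun t ht u hu => by
    linarith [hrs t ht, hle t ht u hu]
  have key' : ∀ t ∈ Icc 0 (Real.pi / 2), ∀ u ∈ Icc 0 (Real.pi / 2),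
      - (2 * r u * s t) * Real.sin (u - t) ≤ s u ^ 2 - s t ^ 2 := fun t ht u hu => by
    have := key u hu t ht
    rw [← neg_sub u t, Real.sin_neg] at this
    linarith
  have hanti : ∀ t ∈ Icc 0 (Real.pi / 2), ∀ u ∈ Icc 0 (Real.pi / 2), t ≤ u → s u ≤ s t := by
    intro t ht u hu htu
    have h2 : 0 ≤ Real.sin (u - t) :=
      Real.sin_nonneg_of_nonneg_of_le_pi (by linarith) (by linarith [hu.2, ht.1])
    have := key t ht u hu
    have h3 : 0 ≤ 2 * r t * s u * Real.sin (u - t) :=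
      mul_nonneg (mul_nonneg (mul_nonneg (by norm_num) (hr t)) (hs u)) h2
    exact abs_le_of_sq_le_sq' (by linarith) (hs t) |>.2
  have hlip : ∀ t ∈ Icc 0 (Real.pi / 2), ∀ u ∈ Icc 0 (Real.pi / 2),
      s u ^ 2 - s t ^ 2 ≤ 2 * |u - t| := by
    intro t ht u hu
    refine (key t ht u hu).trans ((le_abs_self _).trans ?_)
    rw [abs_mul, abs_neg, abs_of_nonneg (by have := hr t; have := hs u; positivity)]
    have h2 : 2 * r t * s u ≤ 2 := by nlinarith [hr t, hs u, hr1 t ht, hs1 u hu]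
    exact mul_le_mul h2 Real.abs_sin_le_abs (abs_nonneg _) (by norm_num)
  have hcontS : ContinuousOn (fun t => s t ^ 2) (Icc 0 (Real.pi / 2)) := by
    have : LipschitzOnWith 2 (fun t => s t ^ 2) (Icc 0 (Real.pi / 2)) := by
      refine LipschitzOnWith.of_dist_le_mul fun t ht u hu => ?_
      rw [Real.dist_eq, Real.dist_eq, abs_le]
      have a := hlip t ht u hu
      have b := hlip u hu t ht
      rw [abs_sub_comm] at a
      constructor <;> push_cast <;> linarith
    exact this.continuousOn
  have hsq : ∀ t, s t = Real.sqrt (s t ^ 2) := fun t => (Real.sqrt_sq (hs t)).symm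
  have hconts : ContinuousOn s (Icc 0 (Real.pi / 2)) :=
    (hcontS.sqrt).congr fun t _ => hsq t
  have hcontr : ContinuousOn r (Icc 0 (Real.pi / 2)) :=
    ((continuousOn_const (c := (1 : ℝ))).sub hcontS).sqrt.congr fun t ht => by
      simp only [Pi.sub_apply]
      rw [← hrs t ht, add_sub_cancel_right, Real.sqrt_sq (hr t)]
  have hder : ∀ t ∈ Ioo 0 (Real.pi / 2), HasDerivAt (fun t => s t ^ 2) (-(2 * r t * s t)) t := by
    intro t ht
    have hnhds : Icc 0 (Real.pi / 2) ∈ nhds t := Icc_mem_nhds ht.1 ht.2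
    have hct := (hconts.continuousAt hnhds).tendsto.mono_left (nhdsWithin_le_nhds (s := {t}ᶜ))
    have hcr := (hcontr.continuousAt hnhds).tendsto.mono_left (nhdsWithin_le_nhds (s := {t}ᶜ))
    have hsin : Filter.Tendsto (fun u => Real.sin (u - t) / (u - t)) (nhdsWithin t {t}ᶜ)
        (nhds 1) := by
      have : HasDerivAt (fun u => Real.sin (u - t)) 1 t := by
        simpa using ((hasDerivAt_id t).sub_const t).sin
      rw [hasDerivAt_iff_tendsto_slope] at this
      refine this.congr fun u => ?_
      simp [slope_def_field]
    rw [hasDerivAt_iff_tendsto_slope]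
    have l1 : Filter.Tendsto (fun u => -(2 * r t * s u) * (Real.sin (u - t) / (u - t)))
        (nhdsWithin t {t}ᶜ) (nhds (-(2 * r t * s t))) := by
      simpa using ((hct.const_mul (2 * r t)).neg).mul hsin
    have l2 : Filter.Tendsto (fun u => -(2 * r u * s t) * (Real.sin (u - t) / (u - t)))
        (nhdsWithin t {t}ᶜ) (nhds (-(2 * r t * s t))) := by
      simpa using (((hcr.const_mul 2).mul_const (s t)).neg).mul hsin
    -- `key` and `key'` bound the slope from opposite sides, and dividing by `u - t` swaps them when
    -- `u < t`; `min` and `max` cover both signs.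
    have lmin := l1.min l2
    have lmax := l1.max l2
    rw [min_self] at lmin
    rw [max_self] at lmax
    have hev : ∀ᶠ u in nhdsWithin t {t}ᶜ, u ∈ Icc 0 (Real.pi / 2) ∧ u ≠ t :=
      (Filter.Eventually.filter_mono nhdsWithin_le_nhds hnhds).and self_mem_nhdsWithin
    have htI : t ∈ Icc 0 (Real.pi / 2) := Ioo_subset_Icc_self ht
    refine tendsto_of_tendsto_of_tendsto_of_le_of_le' lmin lmax ?_ ?_
    · filter_upwards [hev] with u hu
      rw [slope_def_field, ← mul_div_assoc, ← mul_div_assoc]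
      rcases lt_or_gt_of_ne hu.2 with h | h
      · exact (min_le_left _ _).trans
          (div_le_div_of_nonpos_of_le (by linarith) (key t htI u hu.1))
      · exact (min_le_right _ _).trans
          (div_le_div_of_nonneg_right (key' t htI u hu.1) (by linarith))
    · filter_upwards [hev] with u hu
      rw [slope_def_field, ← mul_div_assoc, ← mul_div_assoc]
      rcases lt_or_gt_of_ne hu.2 with h | h
      · exact (div_le_div_of_nonpos_of_le (by linarith) (key' t htI u hu.1)).trans
          (le_max_right _ _)
      · exact (div_le_div_of_nonneg_right (key t htI u hu.1) (by linarith)).trans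
          (le_max_left _ _)
  -- Here `s' = -r = -√(1 - s²)`, so `arcsin s + t` is a first integral away from `s = 0` and `s =
  -- 1`.
  have hderα : ∀ t ∈ Ioo 0 (Real.pi / 2), 0 < s t → s t < 1 →
      HasDerivAt (fun t => Real.arcsin (s t) + t) 0 t := by
    intro t ht hpos hlt
    have hrt : Real.sqrt (1 - s t ^ 2) = r t := by
      rw [← hrs t (Ioo_subset_Icc_self ht), add_sub_cancel_right, Real.sqrt_sq (hr t)]
    have hrpos : 0 < r t := by
      rw [← hrt]; exact Real.sqrt_pos.2 (by nlinarith)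
    have d1 : HasDerivAt s (-r t) t := by
      have := (hder t ht).sqrt (by positivity)
      simp only [Real.sqrt_sq (hs _)] at this
      convert this using 1
      field_simp
    have d2 := (Real.hasDerivAt_arcsin (x := s t) (by linarith) (by linarith)).comp t d1
    rw [hrt] at d2
    exact (d2.add (hasDerivAt_id t)).congr_deriv (by field_simp; ring)
  have hcontα : ContinuousOn (fun t => Real.arcsin (s t) + t) (Icc 0 (Real.pi / 2)) :=
    (Real.continuous_arcsin.comp_continuousOn hconts).add continuousOn_id
  have hconst : ∀ a ∈ Icc 0 (Real.pi / 2), ∀ b ∈ Icc 0 (Real.pi / 2), a < b →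
      (∀ t ∈ Ioo a b, 0 < s t ∧ s t < 1) →
      Real.arcsin (s a) + a = Real.arcsin (s b) + b := by
    intro a ha b hb hab h
    obtain ⟨c, hc, hc'⟩ := exists_hasDerivAt_eq_slope (fun t => Real.arcsin (s t) + t) (fun _ => 0)
      hab (hcontα.mono (Icc_subset_Icc ha.1 hb.2)) fun t ht =>
        hderα t ⟨ha.1.trans_lt ht.1, ht.2.trans_le hb.2⟩ (h t ht).1 (h t ht).2
    have : b - a ≠ 0 := by linarith
    field_simp at hc'
    linarith
  have hmem0 : (0 : ℝ) ∈ Icc 0 (Real.pi / 2) := ⟨le_rfl, by positivity⟩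
  have hmem1 : Real.pi / 2 ∈ Icc 0 (Real.pi / 2) := ⟨by positivity, le_rfl⟩
  have hclosed : ∀ c, IsClosed (Icc 0 (Real.pi / 2) ∩ s ⁻¹' {c}) := fun c =>
    hconts.preimage_isClosed_of_isClosed isClosed_Icc isClosed_singleton
  -- The ODE alone would let `s` linger at 1 or 0. Between the last time `a` with `s = 1` and the
  -- first time `b` with `s = 0` the first integral gives `b - a = π/2`, the whole interval.
  have hint : ∀ t ∈ Ioo 0 (Real.pi / 2), 0 < s t ∧ s t < 1 := by
    have hA : IsCompact (Icc 0 (Real.pi / 2) ∩ s ⁻¹' {1}) :=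
      isCompact_Icc.of_isClosed_subset (hclosed 1) inter_subset_left
    have hB : IsCompact (Icc 0 (Real.pi / 2) ∩ s ⁻¹' {0}) :=
      isCompact_Icc.of_isClosed_subset (hclosed 0) inter_subset_left
    obtain ⟨a, ⟨haI, ha⟩, hamax⟩ := hA.exists_isGreatest ⟨0, hmem0, h0⟩
    obtain ⟨b, ⟨hbI, hb⟩, hbmin⟩ := hB.exists_isLeast ⟨_, hmem1, h1⟩
    simp only [mem_preimage, mem_singleton_iff] at ha hb
    have hab : a < b := by
      by_contra! h
      have := hanti b hbI a haI h
      linarith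
    have hmid : ∀ t ∈ Ioo a b, 0 < s t ∧ s t < 1 := by
      intro t ht
      have htI : t ∈ Icc 0 (Real.pi / 2) := ⟨haI.1.trans ht.1.le, ht.2.le.trans hbI.2⟩
      refine ⟨(hs t).lt_of_ne fun h => ?_, (hs1 t htI).lt_of_ne fun h => ?_⟩
      · exact absurd (hbmin ⟨htI, h.symm⟩) (not_le.2 ht.2)
      · exact absurd (hamax ⟨htI, h⟩) (not_le.2 ht.1)
    have := hconst a haI b hbI hab hmid
    rw [ha, hb, Real.arcsin_one, Real.arcsin_zero] at this
    have ha0 : a = 0 := by linarith [haI.1, hbI.2]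
    have hb0 : b = Real.pi / 2 := by linarith [haI.1, hbI.2]
    rwa [ha0, hb0] at hmid
  have hst : s t = Real.cos t := by
    rcases ht.1.eq_or_lt with h | h
    · rw [← h, h0, Real.cos_zero]
    · have := hconst 0 hmem0 t ht h fun u hu => hint u ⟨hu.1, hu.2.trans_le ht.2⟩
      rw [h0, Real.arcsin_one] at this
      rw [← Real.sin_arcsin (by linarith [hs t]) (hs1 t ht),
        show Real.arcsin (s t) = Real.pi / 2 - t by linarith, Real.sin_pi_div_two_sub]
  refine ⟨hst, ?_⟩
  have h2 : 0 ≤ Real.sin t := Real.sin_nonneg_of_nonneg_of_le_pi ht.1 (by linarith [ht.2])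
  rw [← abs_of_nonneg (hr t), ← abs_of_nonneg h2, ← sq_eq_sq_iff_abs_eq_abs]
  have := hrs t ht
  rw [hst] at this
  linarith [Real.sin_sq_add_cos_sq t]

/-! ### Area in polar coordinates and its equality case -/

/-- The radial function of a plane set `L`: the largest distance from the origin to a point of `L`
in the direction of angle `t`. -/
noncomputable def radialFun (L : Set (ℝ × ℝ)) (t : ℝ) : ℝ :=
  sSup {r | 0 ≤ r ∧ (r * Real.cos t, r * Real.sin t) ∈ L}

/-- A closed plane set of diameter at most `1`, star-shaped with respect to the origin, and
lying above the horizontal axis. -/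
structure IsUpperStarBody (L : Set (ℝ × ℝ)) : Prop where
  isClosed : IsClosed L
  zero_mem : (0, 0) ∈ L
  smul_mem : ∀ p ∈ L, ∀ c ∈ Icc (0 : ℝ) 1, (c * p.1, c * p.2) ∈ L
  nonneg : ∀ p ∈ L, 0 ≤ p.2
  dist_le : ∀ p ∈ L, ∀ q ∈ L, (p.1 - q.1) ^ 2 + (p.2 - q.2) ^ 2 ≤ 1

namespace IsUpperStarBody

variable {L : Set (ℝ × ℝ)}

theorem le_one_of_mem (h : IsUpperStarBody L) {r t : ℝ} (hr : 0 ≤ r)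
    (hm : (r * Real.cos t, r * Real.sin t) ∈ L) : r ≤ 1 := by
  have := h.dist_le _ hm _ h.zero_mem
  simp only [sub_zero, mul_pow, ← mul_add, Real.cos_sq_add_sin_sq, mul_one] at this
  nlinarith

theorem isClosed_ray (h : IsUpperStarBody L) (t : ℝ) :
    IsClosed {r | 0 ≤ r ∧ (r * Real.cos t, r * Real.sin t) ∈ L} :=
  isClosed_Ici.inter (h.isClosed.preimage (f := fun r : ℝ => (r * Real.cos t, r * Real.sin t))
    (by fun_prop))

theorem bddAbove_ray (h : IsUpperStarBody L) (t : ℝ) :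
    BddAbove {r | 0 ≤ r ∧ (r * Real.cos t, r * Real.sin t) ∈ L} :=
  ⟨1, fun _ hr => h.le_one_of_mem hr.1 hr.2⟩

theorem radialFun_mem (h : IsUpperStarBody L) (t : ℝ) :
    0 ≤ radialFun L t ∧ (radialFun L t * Real.cos t, radialFun L t * Real.sin t) ∈ L :=
  (h.isClosed_ray t).csSup_mem ⟨0, le_rfl, by simpa using h.zero_mem⟩ (h.bddAbove_ray t)

theorem mem_iff (h : IsUpperStarBody L) {r t : ℝ} (hr : 0 ≤ r) :
    (r * Real.cos t, r * Real.sin t) ∈ L ↔ r ≤ radialFun L t := by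
  refine ⟨fun hm => le_csSup (h.bddAbove_ray t) ⟨hr, hm⟩, fun hle => ?_⟩
  rcases hr.eq_or_lt with rfl | hpos
  · simpa using h.zero_mem
  have hρ : 0 < radialFun L t := hpos.trans_le hle
  have := h.smul_mem _ (h.radialFun_mem t).2 (r / radialFun L t)
    ⟨by positivity, (div_le_one hρ).2 hle⟩
  simpa only [← mul_assoc, div_mul_cancel₀ _ hρ.ne'] using this

theorem radialFun_le_one (h : IsUpperStarBody L) (t : ℝ) : radialFun L t ≤ 1 :=
  h.le_one_of_mem (h.radialFun_mem t).1 (h.radialFun_mem t).2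

theorem isClosed_le_radialFun (h : IsUpperStarBody L) (c : ℝ) :
    IsClosed {t | c ≤ radialFun L t} := by
  rcases le_total c 0 with hc | hc
  · convert isClosed_univ
    exact eq_univ_of_forall fun t => hc.trans (h.radialFun_mem t).1
  · simp only [← h.mem_iff hc]
    exact h.isClosed.preimage (f := fun t : ℝ => (c * Real.cos t, c * Real.sin t)) (by fun_prop)

theorem measurable_radialFun (h : IsUpperStarBody L) : Measurable (radialFun L) :=
  measurable_of_Ici fun c => (h.isClosed_le_radialFun c).measurableSet

theorem radialFun_eq_zero (h : IsUpperStarBody L) {t : ℝ} (ht : t ∈ Ioo (-Real.pi) 0) :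
    radialFun L t = 0 := by
  have h1 := h.nonneg _ (h.radialFun_mem t).2
  have h2 := Real.sin_neg_of_neg_of_neg_pi_lt ht.2 ht.1
  have h3 := (h.radialFun_mem t).1
  simp only at h1
  nlinarith

/-- Law of cosines: the directions `t` and `u + π/2` make an angle with cosine `-sin (u - t)`. -/
theorem add_sq_le_one (h : IsUpperStarBody L) (t u : ℝ) :
    radialFun L t ^ 2 + radialFun L (u + Real.pi / 2) ^ 2 +
      2 * radialFun L t * radialFun L (u + Real.pi / 2) * Real.sin (u - t) ≤ 1 := by
  have := h.dist_le _ (h.radialFun_mem t).2 _ (h.radialFun_mem (u + Real.pi / 2)).2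
  simp only [Real.cos_add_pi_div_two, Real.sin_add_pi_div_two] at this
  rw [Real.sin_sub]
  refine le_trans (le_of_eq ?_) this
  linear_combination (-(radialFun L t) ^ 2) * Real.sin_sq_add_cos_sq t +
    (-(radialFun L (u + Real.pi / 2)) ^ 2) * Real.sin_sq_add_cos_sq u

theorem sq_add_sq_le_one (h : IsUpperStarBody L) (t : ℝ) :
    radialFun L t ^ 2 + radialFun L (t + Real.pi / 2) ^ 2 ≤ 1 := by
  simpa using h.add_sq_le_one t t

theorem lintegral_ray (h : IsUpperStarBody L) (t : ℝ) :
    ∫⁻ r in Ioi (0 : ℝ), ENNReal.ofReal r *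
      L.indicator 1 (r * Real.cos t, r * Real.sin t) =
    ENNReal.ofReal (radialFun L t ^ 2 / 2) := by
  have hρ := (h.radialFun_mem t).1
  calc _ = ∫⁻ r in Ioi (0 : ℝ), (Iic (radialFun L t)).indicator (fun r => ENNReal.ofReal r) r := by
        refine setLIntegral_congr_fun measurableSet_Ioi fun r hr => ?_
        by_cases hm : r ≤ radialFun L t
        · simp [indicator, h.mem_iff (le_of_lt hr), hm]
        · simp [indicator, h.mem_iff (le_of_lt hr), hm]
    _ = ∫⁻ r in Ioc 0 (radialFun L t), ENNReal.ofReal r := by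
        rw [lintegral_indicator measurableSet_Iic, Measure.restrict_restrict measurableSet_Iic,
          inter_comm, Ioi_inter_Iic]
    _ = ENNReal.ofReal (∫ r in Ioc 0 (radialFun L t), r) := by
        rw [ofReal_integral_eq_lintegral_ofReal]
        · exact (continuous_id.integrableOn_Icc).mono_set Ioc_subset_Icc_self
        · exact (ae_restrict_iff' measurableSet_Ioc).2 (ae_of_all _ fun r hr => hr.1.le)
    _ = _ := by
        rw [← intervalIntegral.integral_of_le hρ, integral_id]
        simp

theorem volume_eq_lintegral (h : IsUpperStarBody L) :
    volume L = ∫⁻ t in Ioo 0 (Real.pi / 2),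
      ENNReal.ofReal ((radialFun L t ^ 2 + radialFun L (t + Real.pi / 2) ^ 2) / 2) := by
  have hpi := Real.pi_pos
  have hmeas := h.measurable_radialFun
  set f : ℝ → ℝ≥0∞ := fun t => ENNReal.ofReal (radialFun L t ^ 2 / 2) with hf
  have hfm : Measurable f := by fun_prop
  have hL := h.isClosed.measurableSet
  have hpolar : volume L = ∫⁻ t in Ioo (-Real.pi) Real.pi, f t := by
    rw [← lintegral_indicator_one hL, ← lintegral_comp_polarCoord_symm]
    simp only [polarCoord_target, polarCoord_symm_apply, smul_eq_mul]
    rw [Measure.volume_eq_prod, ← Measure.prod_restrict, lintegral_prod_symm]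
    · simp only [h.lintegral_ray, hf]
    · refine Measurable.aemeasurable ?_
      refine (ENNReal.measurable_ofReal.comp measurable_fst).mul
        ((measurable_one.indicator hL).comp ?_)
      fun_prop
  have hneg : ∫⁻ t in Ioc (-Real.pi) 0, f t = 0 := by
    rw [← setLIntegral_congr Ioo_ae_eq_Ioc, setLIntegral_congr_fun (g := 0) measurableSet_Ioo]
    · simp
    · intro t ht
      simp [hf, h.radialFun_eq_zero ht]
  have hshift : ∫⁻ t in Ioo (Real.pi / 2) Real.pi, f t =
      ∫⁻ t in Ioo 0 (Real.pi / 2), f (t + Real.pi / 2) := by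
    rw [← (measurePreserving_add_right volume (Real.pi / 2)).setLIntegral_comp_preimage
      measurableSet_Ioo hfm, preimage_add_const_Ioo]
    congr 3 <;> ring
  rw [hpolar, ← Ioc_union_Ioo_eq_Ioo (show -Real.pi ≤ 0 by linarith) hpi,
    lintegral_union measurableSet_Ioo (by
      rw [Set.disjoint_left]; exact fun t h1 h2 => absurd h1.2 (not_le.2 h2.1)),
    hneg, zero_add,
    ← Ioc_union_Ioo_eq_Ioo (show (0 : ℝ) ≤ Real.pi / 2 by linarith)
      (show Real.pi / 2 < Real.pi by linarith),
    lintegral_union measurableSet_Ioo (by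
      rw [Set.disjoint_left]; exact fun t h1 h2 => absurd h1.2 (not_le.2 h2.1)),
    ← setLIntegral_congr Ioo_ae_eq_Ioc, hshift, ← lintegral_add_left hfm]
  refine lintegral_congr fun t => ?_
  rw [hf, ← ENNReal.ofReal_add (by positivity) (by positivity), add_div]

theorem lintegral_half :
    ∫⁻ _ in Ioo 0 (Real.pi / 2), ENNReal.ofReal (1 / 2) = ENNReal.ofReal (Real.pi / 4) := by
  rw [setLIntegral_const, Real.volume_Ioo, ← ENNReal.ofReal_mul (by norm_num)]
  congr 1
  ring

theorem volume_le (h : IsUpperStarBody L) : volume L ≤ ENNReal.ofReal (Real.pi / 4) := by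
  rw [h.volume_eq_lintegral, ← lintegral_half]
  refine lintegral_mono fun t => ENNReal.ofReal_le_ofReal ?_
  linarith [h.sq_add_sq_le_one t]

/-- Maximal area gives equality almost everywhere. As `L` is closed, `radialFun L` is upper
semicontinuous, so strict inequality holds on an open set, which is null and hence empty. -/
theorem sq_add_sq_eq_one (h : IsUpperStarBody L) (hv : ENNReal.ofReal (Real.pi / 4) ≤ volume L)
    {t : ℝ} (ht : t ∈ Ioo 0 (Real.pi / 2)) :
    radialFun L t ^ 2 + radialFun L (t + Real.pi / 2) ^ 2 = 1 := by
  have hle : (fun t => ENNReal.ofReal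
      ((radialFun L t ^ 2 + radialFun L (t + Real.pi / 2) ^ 2) / 2)) ≤ᵐ[
        volume.restrict (Ioo 0 (Real.pi / 2))] fun _ => ENNReal.ofReal (1 / 2) := by
    refine ae_of_all _ fun t => ENNReal.ofReal_le_ofReal ?_
    linarith [h.sq_add_sq_le_one t]
  have hae := ae_eq_of_ae_le_of_lintegral_le hle
    (by rw [← h.volume_eq_lintegral]; exact ne_top_of_le_ne_top ENNReal.ofReal_ne_top h.volume_le)
    aemeasurable_const (by rw [← h.volume_eq_lintegral, lintegral_half]; exact hv)
  rw [Filter.EventuallyEq, ae_restrict_iff' measurableSet_Ioo] at hae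
  have husc : UpperSemicontinuous (radialFun L) :=
    upperSemicontinuous_iff_isClosed_preimage.2 h.isClosed_le_radialFun
  have hsq : UpperSemicontinuous fun t => radialFun L t ^ 2 := by
    refine upperSemicontinuous_iff_isClosed_preimage.2 fun c => ?_
    convert h.isClosed_le_radialFun (Real.sqrt c) using 1
    ext t
    simp [Real.sqrt_le_left (h.radialFun_mem t).1]
  have hsum : UpperSemicontinuous fun t =>
      radialFun L t ^ 2 + radialFun L (t + Real.pi / 2) ^ 2 :=
    hsq.add (hsq.comp (continuous_add_const (Real.pi / 2)))
  have hclosed := upperSemicontinuous_iff_isClosed_preimage.1 hsum 1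
  refine le_antisymm (h.sq_add_sq_le_one t) (by_contra fun hlt => ?_)
  have hopen : IsOpen (Ioo 0 (Real.pi / 2) ∩
      ((fun t => radialFun L t ^ 2 + radialFun L (t + Real.pi / 2) ^ 2) ⁻¹' Ici 1)ᶜ) :=
    isOpen_Ioo.inter hclosed.isOpen_compl
  refine (hopen.measure_pos volume ⟨t, ht, hlt⟩).ne' ?_
  refine measure_mono_null ?_ (ae_iff.1 hae)
  intro u hu hu'
  have := (ENNReal.ofReal_eq_ofReal_iff (by positivity) (by norm_num)).1 (hu' hu.1)
  exact hu.2 (by simp only [mem_preimage, mem_Ici]; linarith)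

theorem radialFun_eq_sin (h : IsUpperStarBody L) (hv : ENNReal.ofReal (Real.pi / 4) ≤ volume L)
    (htop : (0, 1) ∈ L) {t : ℝ} (ht : t ∈ Icc 0 Real.pi) : radialFun L t = Real.sin t := by
  have hpi := Real.pi_pos
  have hone : radialFun L (Real.pi / 2) = 1 :=
    le_antisymm (h.radialFun_le_one _) ((h.mem_iff zero_le_one).1 (by simpa using htop))
  have hzero : radialFun L (Real.pi / 2 + Real.pi / 2) = 0 := by
    have := h.sq_add_sq_le_one (Real.pi / 2)
    rw [hone] at this
    nlinarith [(h.radialFun_mem (Real.pi / 2 + Real.pi / 2)).1]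
  have hsum : ∀ t ∈ Icc 0 (Real.pi / 2),
      radialFun L t ^ 2 + radialFun L (t + Real.pi / 2) ^ 2 = 1 := by
    intro t ht
    rcases ht.1.eq_or_lt with h0 | h0
    · refine le_antisymm (h.sq_add_sq_le_one t) ?_
      rw [← h0, zero_add, hone]
      nlinarith [sq_nonneg (radialFun L 0)]
    rcases ht.2.eq_or_lt with h1 | h1
    · rw [h1, hone, hzero]; norm_num
    · exact h.sq_add_sq_eq_one hv ⟨h0, h1⟩
  have key := fun t ht => eq_cos_of_add_sq_le (r := radialFun L)
    (s := fun t => radialFun L (t + Real.pi / 2)) (fun t => (h.radialFun_mem t).1)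
    (fun t => (h.radialFun_mem _).1) hsum (fun t _ u _ => h.add_sq_le_one t u)
    (by simpa using hone) hzero (t := t) ht
  rcases le_total t (Real.pi / 2) with h1 | h1
  · exact (key t ⟨ht.1, h1⟩).2
  · have := (key (t - Real.pi / 2) ⟨by linarith, by linarith [ht.2]⟩).1
    simpa [Real.cos_sub_pi_div_two] using this

theorem eq_disc (h : IsUpperStarBody L) (hv : ENNReal.ofReal (Real.pi / 4) ≤ volume L)
    (htop : (0, 1) ∈ L) : L = {p | p.1 ^ 2 + p.2 ^ 2 ≤ p.2} := by
  ext p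
  by_cases hp : 0 ≤ p.2
  swap
  · refine iff_of_false (fun hm => hp (h.nonneg p hm)) fun hm => hp ?_
    exact le_trans (by positivity) hm
  set z : ℂ := ⟨p.1, p.2⟩ with hz
  have harg : z.arg ∈ Icc 0 Real.pi := ⟨Complex.arg_nonneg_iff.2 hp, Complex.arg_le_pi z⟩
  have hre : ‖z‖ * Real.cos z.arg = p.1 := Complex.norm_mul_cos_arg z
  have him : ‖z‖ * Real.sin z.arg = p.2 := Complex.norm_mul_sin_arg z
  have hpz : p = (‖z‖ * Real.cos z.arg, ‖z‖ * Real.sin z.arg) := by rw [hre, him]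
  have hn := norm_nonneg z
  have hs := Real.sin_nonneg_of_nonneg_of_le_pi harg.1 harg.2
  rw [hpz, h.mem_iff hn, h.radialFun_eq_sin hv htop harg, mem_ofPred_eq, mul_pow, mul_pow,
    ← mul_add, Real.cos_sq_add_sin_sq, mul_one]
  constructor
  · intro hle
    nlinarith
  · intro hle
    rcases hn.eq_or_lt with h0 | h0
    · rwa [← h0]
    · exact le_of_mul_le_mul_left (by linarith) h0

end IsUpperStarBody

/-! ### Support functions, diameter and normal chords -/

theorem IsCompact.inner_le_supportFun {K : Set Plane} (hK : IsCompact K) {x : Plane} (hx : x ∈ K)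
    (u : Plane) : inner ℝ u x ≤ supportFun K u :=
  le_csSup (hK.image (f := fun x => inner ℝ u x) (by fun_prop)).bddAbove (mem_image_of_mem _ hx)

theorem IsCompact.exists_inner_eq_supportFun {K : Set Plane} (hK : IsCompact K)
    (hne : K.Nonempty) (u : Plane) : ∃ x ∈ K, inner ℝ u x = supportFun K u :=
  (hK.image (f := fun x => inner ℝ u x) (by fun_prop)).sSup_mem (hne.image _)

theorem setDist_supportingLine (K : Set Plane) {u : Plane} (hu : ‖u‖ = 1) :
    setDist (supportingLine K u) (supportingLine K (-u)) =
      |supportFun K u + supportFun K (-u)| := by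
  refine IsLeast.csInf_eq ⟨⟨supportFun K u • u, ?_, -supportFun K (-u) • u, ?_, ?_⟩, ?_⟩
  · simp [supportingLine, inner_smul_right, hu]
  · simp [supportingLine, inner_smul_right, hu]
  · rw [dist_eq_norm, ← sub_smul, norm_smul, hu, mul_one, sub_neg_eq_add, Real.norm_eq_abs]
  · rintro _ ⟨a, ha, b, hb, rfl⟩
    have ha' : inner ℝ u a = supportFun K u := ha
    have hb' : inner ℝ (-u) b = supportFun K (-u) := hb
    have : supportFun K u + supportFun K (-u) = inner ℝ u (a - b) := by
      rw [inner_sub_right, ha', ← hb', inner_neg_left, sub_eq_add_neg]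
    rw [this, dist_eq_norm]
    simpa [hu] using abs_real_inner_le_norm u (a - b)

namespace IsConstantWidthShape

variable {w : ℝ} {K : Set Plane}

theorem supportFun_add_supportFun_neg (h : IsConstantWidthShape w K) {u : Plane} (hu : ‖u‖ = 1) :
    supportFun K u + supportFun K (-u) = w := by
  obtain ⟨x, hx⟩ := h.nonempty
  have h1 := h.isCompact.inner_le_supportFun hx u
  have h2 := h.isCompact.inner_le_supportFun hx (-u)
  rw [inner_neg_left] at h2
  rw [← h.width_eq u hu, setDist_supportingLine K hu, abs_of_nonneg (by linarith)]

theorem inner_sub_le (h : IsConstantWidthShape w K) {u : Plane} (hu : ‖u‖ = 1) {x y : Plane}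
    (hx : x ∈ K) (hy : y ∈ K) : inner ℝ u (x - y) ≤ w := by
  have h1 := h.isCompact.inner_le_supportFun hx u
  have h2 := h.isCompact.inner_le_supportFun hy (-u)
  rw [inner_neg_left] at h2
  rw [inner_sub_right, ← h.supportFun_add_supportFun_neg hu]
  linarith

theorem dist_le (h : IsConstantWidthShape w K) (hw : 0 ≤ w) {x y : Plane}
    (hx : x ∈ K) (hy : y ∈ K) : dist x y ≤ w := by
  rcases eq_or_ne x y with rfl | hne
  · simpa using hw
  have hn : 0 < ‖x - y‖ := norm_pos_iff.2 (sub_ne_zero.2 hne)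
  have hu : ‖(‖x - y‖)⁻¹ • (x - y)‖ = 1 := by
    rw [norm_smul, norm_inv, norm_norm, inv_mul_cancel₀ hn.ne']
  have := h.inner_sub_le hu hx hy
  rw [inner_smul_left, real_inner_self_eq_norm_sq] at this
  rw [dist_eq_norm]
  refine le_trans (le_of_eq ?_) this
  simp only [map_inv₀, conj_trivial]
  field_simp

/-- Opposite support points are the endpoints of a normal chord. -/
theorem exists_add_smul_mem (h : IsConstantWidthShape w K) (hw : 0 ≤ w) {u : Plane}
    (hu : ‖u‖ = 1) : ∃ x ∈ K, x + w • u ∈ K ∧ ∀ y ∈ K, inner ℝ u x ≤ inner ℝ u y := by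
  obtain ⟨x, hx, hxu⟩ := h.isCompact.exists_inner_eq_supportFun h.nonempty (-u)
  obtain ⟨y, hy, hyu⟩ := h.isCompact.exists_inner_eq_supportFun h.nonempty u
  refine ⟨x, hx, ?_, fun z hz => ?_⟩
  · have h1 := h.supportFun_add_supportFun_neg hu
    rw [← hxu, ← hyu, inner_neg_left] at h1
    have h2 : inner ℝ (y - x) u = w := by
      rw [real_inner_comm, inner_sub_right]; linarith
    have h3 := h.dist_le hw hy hx
    rw [dist_eq_norm] at h3
    -- `y - x` has component `w` along `u` and length at most `w`, so nothing is left orthogonal to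
    -- `u`.
    have h4 : ‖y - x - w • u‖ ^ 2 = ‖y - x‖ ^ 2 - w ^ 2 := by
      rw [norm_sub_sq_real, inner_smul_right, h2, norm_smul, hu, Real.norm_eq_abs, mul_one, sq_abs]
      ring
    have h5 : ‖y - x - w • u‖ = 0 := by
      have : ‖y - x - w • u‖ ^ 2 ≤ 0 := by
        rw [h4]; nlinarith [norm_nonneg (y - x)]
      nlinarith [norm_nonneg (y - x - w • u)]
    have h6 : y = x + w • u := by
      rw [norm_eq_zero, sub_sub, sub_eq_zero] at h5
      exact h5
    rwa [← h6]
  · have := h.isCompact.inner_le_supportFun hz (-u)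
    rw [← hxu, inner_neg_left, inner_neg_left] at this
    linarith

end IsConstantWidthShape

/-! ### Enclosed regions and circles -/

theorem enclosedRegion_frontier {K : Set Plane} (hne : K.Nonempty) (hconv : Convex ℝ K)
    (hcomp : IsCompact K) : enclosedRegion (frontier K) = interior K := by
  have hcl := hcomp.isClosed
  ext x
  constructor
  · rintro ⟨hxf, hxb⟩
    by_contra hxi
    have hxK : x ∉ K := fun hx => hxf ⟨subset_closure hx, hxi⟩
    obtain ⟨y, hy⟩ := hne
    have hn : 0 < ‖x - y‖ := norm_pos_iff.2 (sub_ne_zero.2 fun e => hxK (e ▸ hy))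
    set ray : Set Plane := (fun t : ℝ => x + t • (x - y)) '' Ici 0 with hray
    have hconn : IsPreconnected ray :=
      isPreconnected_Ici.image _ (by fun_prop)
    -- The ray leaves `x` away from `y ∈ K`; a point of it in `K` would put `x` on a segment inside
    -- `K`.
    have hsub : ray ⊆ (frontier K)ᶜ := by
      rintro _ ⟨t, ht, rfl⟩ hmem
      have ht0 : (0 : ℝ) ≤ t := ht
      have hz := hcl.frontier_subset hmem
      have hc := hconv hz hy (a := 1 / (1 + t)) (b := t / (1 + t)) (by positivity) (by positivity)
        (by field_simp)
      refine hxK ?_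
      convert hc using 1
      have : (1 + t) ≠ 0 := by positivity
      rw [smul_add, smul_smul, smul_sub, add_assoc, one_div_mul_eq_div, sub_add_cancel, ← add_smul,
        ← add_div, div_self this, one_smul]
    have hx0 : x ∈ ray := ⟨0, self_mem_Ici, by simp⟩
    have hbdd := hxb.subset (hconn.subset_connectedComponentIn hx0 hsub)
    obtain ⟨C, hC⟩ := (Metric.isBounded_iff_subset_closedBall x).1 hbdd
    have := hC ⟨(|C| + 1) / ‖x - y‖, mem_Ici.2 (by positivity), rfl⟩
    rw [Metric.mem_closedBall, dist_eq_norm, add_sub_cancel_left, norm_smul, norm_div, norm_norm,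
      div_mul_cancel₀ _ hn.ne', Real.norm_of_nonneg (by positivity)] at this
    linarith [le_abs_self C]
  · intro hx
    have hxf : x ∉ frontier K := fun h => h.2 hx
    refine ⟨hxf, hcomp.isBounded.subset (Subset.trans ?_ interior_subset)⟩
    refine isPreconnected_connectedComponentIn.subset_left_of_subset_union isOpen_interior
      hcl.isOpen_compl (disjoint_compl_right.mono_left interior_subset) ?_
      ⟨x, mem_connectedComponentIn hxf, hx⟩
    refine (connectedComponentIn_subset _ _).trans fun y hy => ?_
    by_cases hyK : y ∈ K
    · exact Or.inl (by_contra fun h => hy ⟨subset_closure hyK, h⟩)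
    · exact Or.inr hyK

theorem isConstantWidthShape_closedBall (c : Plane) {r : ℝ} (hr : 0 ≤ r) :
    IsConstantWidthShape (2 * r) (Metric.closedBall c r) where
  nonempty := Metric.nonempty_closedBall.2 hr
  convex := convex_closedBall c r
  isCompact := isCompact_closedBall c r
  width_eq := by
    have key : ∀ u : Plane, ‖u‖ = 1 → supportFun (Metric.closedBall c r) u = inner ℝ u c + r := by
      intro u hu
      refine IsGreatest.csSup_eq ⟨⟨c + r • u, ?_, ?_⟩, ?_⟩
      · simp [norm_smul, hu, abs_of_nonneg hr]
      · simp [inner_add_right, inner_smul_right, hu]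
      · rintro _ ⟨x, hx, rfl⟩
        have h1 := real_inner_le_norm u (x - c)
        rw [hu, one_mul, inner_sub_right] at h1
        rw [mem_closedBall_iff_norm] at hx
        simp only
        linarith
    intro u hu
    rw [setDist_supportingLine _ hu, key u hu, key (-u) (by rwa [norm_neg]), inner_neg_left,
      abs_of_nonneg (by linarith)]
    ring

theorem enclosedArea_sphere (c : Plane) {r : ℝ} (hr : 0 < r) :
    enclosedArea (Metric.sphere c r) = ENNReal.ofReal (Real.pi * r ^ 2) := by
  rw [enclosedArea, ← frontier_closedBall c hr.ne', enclosedRegion_frontier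
    (Metric.nonempty_closedBall.2 hr.le) (convex_closedBall c r) (isCompact_closedBall c r),
    interior_closedBall c hr.ne', EuclideanSpace.volume_ball_fin_two,
    ← ENNReal.ofReal_pow hr.le, ← ENNReal.ofReal_mul (by positivity), mul_comm]

/-! ### Transfer to coordinates and conclusion -/

/-- The coordinate chart of the plane centred at `o`. -/
def planeChart (o : Plane) (p : ℝ × ℝ) : Plane := o + !₂[p.1, p.2]

theorem planeChart_apply_one (o : Plane) (p : ℝ × ℝ) : planeChart o p 1 = o 1 + p.2 := by
  simp [planeChart]

theorem planeChart_sub (o x : Plane) : planeChart o (x 0 - o 0, x 1 - o 1) = x := by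
  ext i
  fin_cases i <;> simp [planeChart]

theorem continuous_planeChart (o : Plane) : Continuous (planeChart o) := by
  unfold planeChart
  refine continuous_const.add ((PiLp.continuous_toLp 2 _).comp ?_)
  fun_prop

theorem measurePreserving_planeChart (o : Plane) : MeasurePreserving (planeChart o) :=
  (measurePreserving_add_left volume o).comp
    ((PiLp.volume_preserving_toLp (Fin 2)).comp (volume_preserving_finTwoArrow ℝ).symm)

theorem dist_planeChart_sq (o : Plane) (p q : ℝ × ℝ) :
    dist (planeChart o p) (planeChart o q) ^ 2 = (p.1 - q.1) ^ 2 + (p.2 - q.2) ^ 2 := by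
  rw [EuclideanSpace.dist_eq, Real.sq_sqrt (by positivity), Fin.sum_univ_two]
  simp [planeChart, Real.dist_eq, sq_abs]

theorem IsConstantWidthShape.volume_le_and_eq {K : Set Plane} (h : IsConstantWidthShape 1 K) :
    volume K ≤ ENNReal.ofReal (Real.pi / 4) ∧
      (ENNReal.ofReal (Real.pi / 4) ≤ volume K → ∃ c, K = Metric.closedBall c (1 / 2)) := by
  set e : Plane := EuclideanSpace.single 1 1 with he
  obtain ⟨o, ho, ho', hmin⟩ := h.exists_add_smul_mem zero_le_one (u := e) (by simp [he])
  have hcl := h.isCompact.isClosed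
  have hvol : volume (planeChart o ⁻¹' K) = volume K :=
    (measurePreserving_planeChart o).measure_preimage hcl.measurableSet.nullMeasurableSet
  have hzero : planeChart o (0, 0) = o := by
    ext i
    fin_cases i <;> simp [planeChart]
  have htop : planeChart o (0, 1) = o + (1 : ℝ) • e := by
    ext i
    fin_cases i <;> simp [planeChart, he]
  have hL : IsUpperStarBody (planeChart o ⁻¹' K) :=
    { isClosed := hcl.preimage (continuous_planeChart o)
      zero_mem := by rwa [mem_preimage, hzero]
      smul_mem := by
        intro p hp c hc
        rw [mem_preimage]
        have := h.convex ho hp (a := 1 - c) (b := c) (by linarith [hc.2]) hc.1 (by ring)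
        convert this using 1
        ext i
        fin_cases i <;> simp [planeChart] <;> ring
      nonneg := by
        intro p hp
        have := hmin _ hp
        simp only [he, EuclideanSpace.inner_single_left, planeChart_apply_one] at this
        simpa using this
      dist_le := by
        intro p hp q hq
        rw [← dist_planeChart_sq o]
        exact pow_le_one₀ dist_nonneg (h.dist_le zero_le_one hp hq) }
  refine ⟨hvol ▸ hL.volume_le, fun hv => ⟨planeChart o (0, 1 / 2), ?_⟩⟩
  have hdisc := hL.eq_disc (hvol.symm ▸ hv) (by rwa [mem_preimage, htop])
  ext x
  rw [← planeChart_sub o x, ← mem_preimage, hdisc, Metric.mem_closedBall,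
    ← sq_le_sq₀ dist_nonneg (by norm_num), dist_planeChart_sq, mem_ofPred_eq]
  constructor <;> intro hx <;> simp only at hx ⊢ <;> linarith

theorem mainTheorem4 :
    (∀ c : Plane, IsConstantWidthCurve 1 (Metric.sphere c (1 / 2)) ∧
      enclosedArea (Metric.sphere c (1 / 2)) = ENNReal.ofReal (Real.pi / 4)) ∧
    (∀ Γ : Set Plane, IsConstantWidthCurve 1 Γ →
      enclosedArea Γ ≤ ENNReal.ofReal (Real.pi / 4) ∧
      (enclosedArea Γ = ENNReal.ofReal (Real.pi / 4) ↔
        ∃ c : Plane, Γ = Metric.sphere c (1 / 2))) := by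
  have hcircle : ∀ c : Plane,
      enclosedArea (Metric.sphere c (1 / 2)) = ENNReal.ofReal (Real.pi / 4) := fun c => by
    rw [enclosedArea_sphere c (by norm_num)]
    congr 1
    ring
  refine ⟨fun c => ⟨⟨Metric.closedBall c (1 / 2), ?_, ?_⟩, hcircle c⟩, ?_⟩
  · simpa using isConstantWidthShape_closedBall c (r := 1 / 2) (by norm_num)
  · exact (frontier_closedBall c (by norm_num)).symm
  rintro _ ⟨K, hK, rfl⟩
  obtain ⟨hle, heq⟩ := hK.volume_le_and_eq
  -- This inequality suffices for both claims, so the boundary need not be shown null.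
  have harea : enclosedArea (frontier K) ≤ volume K := by
    rw [enclosedArea, enclosedRegion_frontier hK.nonempty hK.convex hK.isCompact]
    exact measure_mono interior_subset
  refine ⟨harea.trans hle, fun h => ?_, fun ⟨c, hc⟩ => hc ▸ hcircle c⟩
  obtain ⟨c, rfl⟩ := heq (h ▸ harea)
  exact ⟨c, frontier_closedBall c (by norm_num)⟩
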